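/- **Setting.** A typical user sits at the origin of $\mathbb R^2$. It is served by a transmitter (TX) at a fixed location $T_0\neq 0$ which has an assisting reconfigurable intelligent surface (RIS) with $N\ge 1$ elements at a fixed location $R_0\ne 0$, $|T_0-R_0|=d_0>0$. The other TXs form a homogeneous Poisson point process $\{x_k\}$ of density $\lambda_t>0$ in the plane; independently of each other, each of them has an assisting RIS with probability $p\in[0,1]$ ($b_k=1$) and none with probability $1-p$ ($b_k=0$). Let $\alpha>2$ be the path loss exponent, $C_d,C_r>0$ the path losses per unit distance of the direct and the reflected link, $m_h,m_r>0$ the Nakagami shape parameters of the two hops of the reflected link, $\gamma_t=P/\sigma_0^2>0$ the ratio of transmit power to noise power, and $\bar\gamma\ge 0$ the SINR threshold. Put $\eta_g(d)=C_d d^{-\alpha}$, $\eta_h(d)=C_r(d_0d)^{-\alpha}$, $\eta_{g,0}=\eta_g(|T_0|)$, $\eta_{h,0}=\eta_h(|R_0|)$ and $e_1=C_d+NC_rd_0^{-\alpha}$. **Moment matching.** Let $$a=\frac{\Gamma(m_h+\frac12)}{\Gamma(m_h)}\frac{\Gamma(m_r+\frac12)}{\Gamma(m_r)}\Big(\frac1{m_hm_r}\Big)^{1/2},\quad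 M_1=Na,\quad M_2=N+N(N-1)a^2,\quad \kappa_r=\frac{M_1^2}{M_2-M_1^2},\quad \omega_r=\frac{M_2-M_1^2}{M_1},$$ $\mu^g_q=\Gamma(1+\frac q2)$, $\mu^\varsigma_q=\omega_r^q\,\Gamma(q+\kappa_r)/\Gamma(\kappa_r)$, $\beta=\sqrt{\eta_{h,0}/\eta_{g,0}}$, $$\chi_1=\mu^g_2+2\beta\mu^g_1\mu^\varsigma_1+\beta^2\mu^\varsigma_2,\qquad \chi_2=\mu^g_4+4\beta\mu^g_3\mu^\varsigma_1+6\beta^2\mu^g_2\mu^\varsigma_2+4\beta^3\mu^g_1\mu^\varsigma_3+\beta^4\mu^\varsigma_4,$$ $$\kappa_s=\frac{\chi_1^2}{\chi_2-\chi_1^2},\qquad \omega_s=\eta_{g,0}\frac{\chi_2-\chi_1^2}{\chi_1},$$ and let $\hat\kappa_s\ge1$ be the positive integer nearest to $\kappa_s$ (half-integers are rounded up). **Approximations.** The signal power $S_0^+$ is taken to be gamma distributed with shape $\hat\kappa_s$ and scale $\omega_s$. The interference power is $I=\sum_k I_k$ with $$I_k=\begin{cases}\big|\sqrt{\eta_g(|x_k|)}\,g_k+\sqrt{\eta_h(|x_k|)}\,I_{r,k}\big|^2,&b_k=1,\\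 \big|\sqrt{\eta_g(|x_k|)}\,g_k\big|^2,&b_k=0,\end{cases}$$ where $g_k\sim\mathcal{CN}(0,1)$ and $I_{r,k}\sim\mathcal{CN}(0,N)$; that is, the sum of the $N$ scattered paths is replaced by its Gaussian limit, and the distance from the RIS of an interfering TX to the user by the distance of that TX to the user. The variables $S_0^+$, $\{x_k\}$, $b_k$, $g_k$, $I_{r,k}$ ($k\in\mathbb N$) are independent. **Claim.** Almost surely $I<\infty$, and the coverage probability of the user, with $\gamma_0^+=S_0^+/(I+\gamma_t^{-1})$, is $$\mathbb P\big(\gamma_0^+>\bar\gamma\big)=\sum_{i=0}^{\hat\kappa_s-1}\frac{(-1)^i}{i!}\left[\frac{\partial^i}{\partial s^i}\exp\big(V(s)\big)\right]_{s=1},$$ where $$V(s)=-\frac{s\bar\gamma}{\omega_s}\gamma_t^{-1}-\frac{2\pi^2\lambda_tp\csc\left(\frac{2\pi}\alpha\right)\left(\frac{e_1\bar\gamma}{\omega_s}s\right)^{2/\alpha}}{\alpha}-\frac{2\pi^2\lambda_t(1-p)\csc\left(\frac{2\pi}\alpha\right)\left(\frac{C_d\bar\gamma}{\omega_s}s\right)^{2/\alpha}}{\alpha}.$$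 -/

import Mathlib

open MeasureTheory ProbabilityTheory
open scoped NNReal ENNReal

noncomputable section

namespace RISNetwork

/-- The plane in which transmitters (TXs), reconfigurable intelligent surfaces (RISs) and users
live. The typical user sits at the origin. -/
abbrev Plane : Type := EuclideanSpace ℝ (Fin 2)

/-! ### Probabilistic notions -/

/-- The (random) counting measure `∑ₖ δ_{X k}` of the point configuration `{X k}`. -/
def pointMeasure {Ω : Type*} (X : ℕ → Ω → Plane) (ω : Ω) : Measure Plane :=
  Measure.sum fun k => Measure.dirac (X k ω)

/-- `X 0, X 1, …` enumerates the points of a homogeneous Poisson point process of intensity `lam`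
in the plane: the number of points in a Borel set of finite area is Poisson with mean
`lam * area`, and the numbers of points in pairwise disjoint sets are independent. -/
structure IsHomogeneousPoisson {Ω : Type*} [MeasurableSpace Ω] (X : ℕ → Ω → Plane) (lam : ℝ)
    (μ : Measure Ω) : Prop where
  measurable : ∀ k, Measurable (X k)
  hasLaw_count : ∀ B : Set Plane, MeasurableSet B → volume B ≠ ⊤ →
    HasLaw (fun ω => pointMeasure X ω B)
      ((poissonMeasure (lam * volume.real B).toNNReal).map (fun n : ℕ => (n : ℝ≥0∞))) μ
  indep_count : ∀ (n : ℕ) (B : Fin n → Set Plane), (∀ i, MeasurableSet (B i)) →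
    (∀ i, volume (B i) ≠ ⊤) → Pairwise (fun i j => Disjoint (B i) (B j)) →
    iIndepFun (fun i ω => pointMeasure X ω (B i)) μ

/-- The circularly symmetric complex Gaussian law `CN(0, v)`: independent real and imaginary
parts, each with law `N(0, v/2)`. -/
def complexGaussian (v : ℝ≥0) : Measure ℂ :=
  ((gaussianReal 0 (v / 2)).prod (gaussianReal 0 (v / 2))).map
    (fun z : ℝ × ℝ => (⟨z.1, z.2⟩ : ℂ))

/-! ### Parameters of the network -/

/-- Deterministic parameters of the network with fixed association to a TX that has an assisting
RIS. -/
structure Params where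
  /-- density of the TXs -/
  lam : ℝ
  /-- probability that a TX has an assisting RIS -/
  p : unitInterval
  /-- path loss exponent -/
  α : ℝ
  /-- path loss per unit distance of the direct link -/
  Cd : ℝ
  /-- path loss per unit distance of the reflected link -/
  Cr : ℝ
  /-- distance between a TX and its RIS -/
  d0 : ℝ
  /-- number of elements of each RIS -/
  N : ℕ
  /-- Nakagami shape parameter of the TX-RIS channels -/
  mh : ℝ
  /-- Nakagami shape parameter of the RIS-user channels -/
  mr : ℝ
  /-- transmit power -/
  P : ℝ
  /-- noise power -/
  noise : ℝ
  /-- location of the serving TX -/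
  T0 : Plane
  /-- location of the RIS of the serving TX -/
  R0 : Plane
  lam_pos : 0 < lam
  two_lt_α : 2 < α
  Cd_pos : 0 < Cd
  Cr_pos : 0 < Cr
  d0_pos : 0 < d0
  N_pos : 0 < N
  mh_pos : 0 < mh
  mr_pos : 0 < mr
  P_pos : 0 < P
  noise_pos : 0 < noise
  T0_ne : T0 ≠ 0
  R0_ne : R0 ≠ 0
  dist_T0_R0 : dist T0 R0 = d0

namespace Params

variable (c : Params)

/-- Transmit signal-to-noise ratio `P / σ₀²`. -/
def snr : ℝ := c.P / c.noise

/-- Path loss of a direct link of length `d`. -/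
def etaG (d : ℝ) : ℝ := c.Cd * d ^ (-c.α)

/-- Path loss of a reflected path whose RIS-user distance is `d`. -/
def etaH (d : ℝ) : ℝ := c.Cr * (c.d0 * d) ^ (-c.α)

/-! ### Moment matching of the signal power -/

/-- Mean of `|h| |r|` for independent Nakagami variables of unit spread and shapes `mh`, `mr`. -/
def meanProd : ℝ :=
  (Real.Gamma (c.mh + 1 / 2) / Real.Gamma c.mh) * (Real.Gamma (c.mr + 1 / 2) / Real.Gamma c.mr) *
    (1 / (c.mh * c.mr)) ^ (1 / 2 : ℝ)

/-- First moment of `S_r = ∑ₙ |hₙ| |rₙ|`. -/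
def meanSr : ℝ := c.N * c.meanProd

/-- Second moment of `S_r`. -/
def secondSr : ℝ := c.N + c.N * (c.N - 1) * c.meanProd ^ 2

/-- Shape of the gamma variable matched to `S_r`. -/
def kappaR : ℝ := c.meanSr ^ 2 / (c.secondSr - c.meanSr ^ 2)

/-- Scale of the gamma variable matched to `S_r`. -/
def omegaR : ℝ := (c.secondSr - c.meanSr ^ 2) / c.meanSr

/-- `q`-th moment of the Rayleigh variable `|g₀|`. -/
def muG (q : ℕ) : ℝ := Real.Gamma (1 + (q : ℝ) / 2)

/-- `q`-th moment of the gamma variable matched to `S_r`. -/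
def muS (q : ℕ) : ℝ := c.omegaR ^ q * (Real.Gamma (q + c.kappaR) / Real.Gamma c.kappaR)

/-- `β = √(η_{h,0} / η_{g,0})`. -/
def beta : ℝ := √(c.etaH ‖c.R0‖ / c.etaG ‖c.T0‖)

def chi1 : ℝ := muG 2 + 2 * c.beta * muG 1 * c.muS 1 + c.beta ^ 2 * c.muS 2

def chi2 : ℝ :=
  muG 4 + 4 * c.beta * muG 3 * c.muS 1 + 6 * c.beta ^ 2 * muG 2 * c.muS 2 +
    4 * c.beta ^ 3 * muG 1 * c.muS 3 + c.beta ^ 4 * c.muS 4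

/-- Shape of the gamma variable matched to the signal power `S₀⁺`. -/
def kappaS : ℝ := c.chi1 ^ 2 / (c.chi2 - c.chi1 ^ 2)

/-- Scale of the gamma variable matched to the signal power `S₀⁺`. -/
def omegaS : ℝ := c.etaG ‖c.T0‖ * ((c.chi2 - c.chi1 ^ 2) / c.chi1)

/-- The positive integer nearest to `kappaS`. -/
def kappaHat : ℕ := max 1 (round c.kappaS).toNat

/-! ### Interference and SINR -/

/-- Interference power `|√η_g g + √η_h I_r|²` of a TX with an assisting RIS, with direct distance
`dg` and RIS-user distance `dr`. -/
def interfRIS (dg dr : ℝ) (g Ir : ℂ) : ℝ :=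
  ‖(√(c.etaG dg) : ℂ) * g + (√(c.etaH dr) : ℂ) * Ir‖ ^ 2

/-- Interference power `|√η_g g|²` of a TX without RIS. -/
def interfDirect (dg : ℝ) (g : ℂ) : ℝ := ‖(√(c.etaG dg) : ℂ) * g‖ ^ 2

/-- Interference power of a TX at `x` with mark `(b, g, I_r)`; `b` says whether the TX has a RIS.
The RIS-user distance is approximated by the TX-user distance. -/
def interfTerm (x : Plane) (m : Bool × ℂ × ℂ) : ℝ :=
  if m.1 then c.interfRIS ‖x‖ ‖x‖ m.2.1 m.2.2 else c.interfDirect ‖x‖ m.2.1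

/-- SINR of the typical user for signal power `S`, interfering TXs at `x k` and marks `m k`. -/
def sinr (S : ℝ) (x : ℕ → Plane) (m : ℕ → Bool × ℂ × ℂ) : ℝ :=
  S / ((∑' k, c.interfTerm (x k) (m k)) + c.snr⁻¹)

/-- `e₁ = C_d + N C_r d₀^{-α}`. -/
def e1 : ℝ := c.Cd + c.N * c.Cr * c.d0 ^ (-c.α)

/-- The exponent `V(s)` at SINR threshold `thr`; the cosecant is written as `1 / sin`. -/
def V (thr s : ℝ) : ℝ :=
  -(s * thr / c.omegaS) * c.snr⁻¹
    - 2 * Real.pi ^ 2 * c.lam * c.p * (1 / Real.sin (2 * Real.pi / c.α)) *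
        (c.e1 * thr / c.omegaS * s) ^ (2 / c.α) / c.α
    - 2 * Real.pi ^ 2 * c.lam * (1 - c.p) * (1 / Real.sin (2 * Real.pi / c.α)) *
        (c.Cd * thr / c.omegaS * s) ^ (2 / c.α) / c.α

end Params

/-- The random network with fixed association, under the approximations of the analysis.
`S` is the signal power, gamma distributed with integer shape; `X` are the TXs other than the
serving one; the mark `M k = (b, g, I_r)` of the `k`-th TX consists of the RIS indicator, the
direct fading coefficient and the sum of the scattered paths of its RIS, which is approximated by a
complex Gaussian variable of variance `N`. -/
structure IsFixedAssociation (c : Params) {Ω : Type*} [MeasurableSpace Ω] (μ : Measure Ω)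
    (S : Ω → ℝ) (X : ℕ → Ω → Plane) (M : ℕ → Ω → Bool × ℂ × ℂ) : Prop where
  law_signal : HasLaw S (gammaMeasure c.kappaHat (1 / c.omegaS)) μ
  poisson : IsHomogeneousPoisson X c.lam μ
  law_mark : ∀ k, HasLaw (M k)
    ((bernoulliMeasure true false c.p).prod
      ((complexGaussian 1).prod (complexGaussian c.N))) μ
  indep_mark : iIndepFun M μ
  indep_points_marks : IndepFun (fun ω k => X k ω) (fun ω k => M k ω) μ
  indep_signal : IndepFun S (fun ω => ((fun k => X k ω), (fun k => M k ω))) μ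

end RISNetwork

end

/-! Write `I` for the interference power, `σ` for `c.snr` and `Y = (thr / ω_s)(I + σ⁻¹)`. Given `I`,
coverage is the event that a gamma variable of integer shape `n` exceeds `thr (I + σ⁻¹)`, so its
probability is the Erlang tail `e^{-Y} ∑_{i<n} Y^i / i!`. Averaging leaves the quantities `E[Y^i
e^{-Y}]`, which are `(-1)^i` times the derivatives at `s = 1` of `E e^{-sY}`. It remains to show `E
e^{-sY} = e^{V(s)}` for `s ≥ 0`.

The noise contributes the linear term of `V`. For the interference, the Laplace functional of an
independently marked Poisson process gives `E e^{-sI} = exp(-λ ∫ (1 - E e^{-s h(x,m)}) dx)`, where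
`h(x,m)` is the power received from a TX at `x` with mark `m`. Given the RIS indicator, this power
is the squared modulus of a complex Gaussian, hence exponential, with mean `e₁ |x|^{-α}` or `C_d
|x|^{-α}`. The planar integral of `1 - (1 + b|x|^{-α})⁻¹` is found in polar coordinates and by
Euler's reflection formula (`integrable_and_integral_pathloss`).

The Laplace functional is proved for `[0, ∞]`-valued sums, so no prior finiteness is needed.
Finiteness of `I` follows from it: `E e^{-sI} → 1` as `s → 0`. -/

open Filter Topology

noncomputable section

namespace RISNetwork

/-! ### The exponential `e^{-t}` on `[0, ∞]` -/

/-- The function `t ↦ exp (-t)` on `[0, ∞]`, with value `0` at `∞`. -/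
def expNeg (t : ℝ≥0∞) : ℝ := if t = ⊤ then 0 else Real.exp (-t.toReal)

lemma expNeg_top : expNeg ⊤ = 0 := by simp [expNeg]

lemma expNeg_zero : expNeg 0 = 1 := by simp [expNeg]

lemma expNeg_of_ne_top {t : ℝ≥0∞} (ht : t ≠ ⊤) : expNeg t = Real.exp (-t.toReal) := by
  simp [expNeg, ht]

lemma expNeg_ofReal {x : ℝ} (hx : 0 ≤ x) : expNeg (ENNReal.ofReal x) = Real.exp (-x) := by
  simp [expNeg, hx]

lemma expNeg_nonneg (t : ℝ≥0∞) : 0 ≤ expNeg t := by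
  unfold expNeg; split_ifs <;> positivity

lemma expNeg_le_one (t : ℝ≥0∞) : expNeg t ≤ 1 := by
  unfold expNeg; split_ifs <;> simp

/-- This form yields continuity at `⊤` from that of the exponential on `EReal`. -/
lemma expNeg_eq_toReal_exp (t : ℝ≥0∞) : expNeg t = (EReal.exp (-(t : EReal))).toReal := by
  induction t with
  | top => simp [expNeg_top]
  | coe x =>
    have : -(((x : ℝ≥0∞)) : EReal) = ((-(x : ℝ) : ℝ) : EReal) := by
      rw [EReal.coe_neg]; rfl
    rw [expNeg_of_ne_top (by simp), this, EReal.exp_coe, ENNReal.toReal_ofReal (by positivity)]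
    simp

lemma continuous_expNeg : Continuous expNeg := by
  rw [continuous_iff_continuousAt]
  intro t
  have h : expNeg = fun t : ℝ≥0∞ => (EReal.exp (-(t : EReal))).toReal := funext expNeg_eq_toReal_exp
  rw [h]
  refine ContinuousAt.comp (f := fun t : ℝ≥0∞ => EReal.exp (-(t : EReal)))
    (g := ENNReal.toReal) (ENNReal.continuousAt_toReal ?_) (Continuous.continuousAt ?_)
  · rw [Ne, EReal.exp_eq_top_iff, EReal.neg_eq_top_iff]
    exact (bot_lt_iff_ne_bot.mp (lt_of_lt_of_le EReal.bot_lt_zero (EReal.coe_ennreal_nonneg t)))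
  · exact ENNReal.continuous_exp.comp (continuous_neg.comp continuous_coe_ennreal_ereal)

lemma measurable_expNeg : Measurable expNeg := continuous_expNeg.measurable

lemma expNeg_add (s t : ℝ≥0∞) : expNeg (s + t) = expNeg s * expNeg t := by
  induction s with
  | top => simp [expNeg_top]
  | coe x =>
    induction t with
    | top => simp [expNeg_top]
    | coe y =>
      rw [← ENNReal.coe_add, expNeg_of_ne_top (by simp), expNeg_of_ne_top (by simp),
        expNeg_of_ne_top (by simp), ← Real.exp_add]
      simp only [ENNReal.coe_toReal, NNReal.coe_add, neg_add]

lemma expNeg_sum {ι : Type*} (s : Finset ι) (f : ι → ℝ≥0∞) :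
    expNeg (∑ i ∈ s, f i) = ∏ i ∈ s, expNeg (f i) := by
  classical
  induction s using Finset.induction_on with
  | empty => simp [expNeg_zero]
  | insert i s hi ih => rw [Finset.sum_insert hi, Finset.prod_insert hi, expNeg_add, ih]

/-- Valid also at `t = ⊤`: for `n = 0` the conventions `⊤ * 0 = 0` and `0 ^ 0 = 1` agree. -/
lemma expNeg_mul_natCast (t : ℝ≥0∞) (n : ℕ) : expNeg (t * n) = expNeg t ^ n := by
  induction n with
  | zero => simp [expNeg_zero]
  | succ n ih => rw [Nat.cast_succ, mul_add, mul_one, expNeg_add, ih, pow_succ]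

lemma expNeg_antitone : Antitone expNeg := by
  intro s t h
  obtain ⟨u, rfl⟩ := exists_add_of_le h
  rw [expNeg_add]
  exact mul_le_of_le_one_right (expNeg_nonneg _) (expNeg_le_one _)

/-- Dominated convergence for `exp (-f)`. -/
lemma tendsto_integral_expNeg {Ω : Type*} [MeasurableSpace Ω] {μ : Measure Ω}
    [IsFiniteMeasure μ] {F : ℕ → Ω → ℝ≥0∞} {G : Ω → ℝ≥0∞} (hF : ∀ n, AEMeasurable (F n) μ)
    (hlim : ∀ ω, Tendsto (fun n => F n ω) atTop (𝓝 (G ω))) :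
    Tendsto (fun n => ∫ ω, expNeg (F n ω) ∂μ) atTop (𝓝 (∫ ω, expNeg (G ω) ∂μ)) := by
  refine tendsto_integral_of_dominated_convergence (fun _ => (1 : ℝ))
    (fun n => (measurable_expNeg.comp_aemeasurable (hF n)).aestronglyMeasurable) (integrable_const _)
    (fun n => ae_of_all _ fun ω => ?_)
    (ae_of_all _ fun ω => (continuous_expNeg.tendsto _).comp (hlim ω))
  rw [Real.norm_eq_abs, abs_of_nonneg (expNeg_nonneg _)]
  exact expNeg_le_one _

/-! ### Laplace functional of the Poisson process -/

/-- This is the Poisson generating function `E z^n = e^{-r(1-z)}` at `z = e^{-a}`. -/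
lemma integral_expNeg_poissonMeasure (r : ℝ≥0) (a : ℝ≥0∞) :
    ∫ t, expNeg (a * t) ∂((poissonMeasure r).map (fun n : ℕ => (n : ℝ≥0∞))) =
      Real.exp (-(r * (1 - expNeg a))) := by
  have hm : Measurable fun t : ℝ≥0∞ => expNeg (a * t) :=
    measurable_expNeg.comp (measurable_const.mul measurable_id)
  rw [integral_map .of_discrete hm.aestronglyMeasurable, integral_poissonMeasure]
  simp_rw [expNeg_mul_natCast, smul_eq_mul]
  have h := (NormedSpace.expSeries_div_hasSum_exp ((r : ℝ) * expNeg a)).mul_left (Real.exp (-r))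
  rw [← Real.exp_eq_exp_ℝ, ← Real.exp_add] at h
  rw [show -((r : ℝ) * (1 - expNeg a)) = -r + r * expNeg a by ring, ← h.tsum_eq]
  refine tsum_congr fun n => ?_
  rw [mul_pow]
  ring

lemma lintegral_pointMeasure {Ω : Type*} (X : ℕ → Ω → Plane) (ω : Ω) {f : Plane → ℝ≥0∞}
    (hf : Measurable f) : ∫⁻ x, f x ∂(pointMeasure X ω) = ∑' k, f (X k ω) := by
  rw [pointMeasure, lintegral_sum_measure]
  exact tsum_congr fun k => lintegral_dirac' _ hf

lemma measurable_pointMeasure_apply {Ω : Type*} [MeasurableSpace Ω] {X : ℕ → Ω → Plane}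
    (hX : ∀ k, Measurable (X k)) {B : Set Plane} (hB : MeasurableSet B) :
    Measurable fun ω => pointMeasure X ω B := by
  have : (fun ω => pointMeasure X ω B) = fun ω => ∑' k, B.indicator 1 (X k ω) := by
    funext ω
    rw [pointMeasure, Measure.sum_apply _ hB]
    exact tsum_congr fun k => Measure.dirac_apply' _ hB
  rw [this]
  exact Measurable.tsum fun k => (measurable_one.indicator hB).comp (hX k)

/-- Laplace functional of a homogeneous Poisson process at a simple function. -/
lemma IsHomogeneousPoisson.integral_expNeg_simpleFunc {Ω : Type*} [MeasurableSpace Ω]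
    {μ : Measure Ω} [IsProbabilityMeasure μ] {X : ℕ → Ω → Plane} {lam : ℝ}
    (hX : IsHomogeneousPoisson X lam μ) (hlam : 0 ≤ lam) (g : SimpleFunc Plane ℝ≥0∞)
    (hg : g.FinMeasSupp volume) :
    ∫ ω, expNeg (∑' k, g (X k ω)) ∂μ =
      expNeg (ENNReal.ofReal lam * ∫⁻ x, ENNReal.ofReal (1 - expNeg (g x))) := by
  classical
  -- The value `0` is discarded: its fibre has infinite area but contributes nothing to either side.
  set s : Finset ℝ≥0∞ := g.range.filter (· ≠ 0) with hs
  have hfin : ∀ a ∈ s, volume (g ⁻¹' {a}) ≠ ⊤ := fun a ha =>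
    ((SimpleFunc.finMeasSupp_iff.mp hg) a (Finset.mem_filter.mp ha).2).ne
  have hsum : ∀ ν : Measure Plane, ∀ φ : ℝ≥0∞ → ℝ≥0∞, φ 0 = 0 →
      ∫⁻ x, φ (g x) ∂ν = ∑ a ∈ s, φ a * ν (g ⁻¹' {a}) := by
    intro ν φ hφ
    have : ∀ x, φ (g x) = (g.map φ) x := fun x => rfl
    simp_rw [this]
    rw [SimpleFunc.lintegral_eq_lintegral, SimpleFunc.map_lintegral, hs, Finset.sum_filter]
    refine Finset.sum_congr rfl fun a _ => ?_
    split_ifs with h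
    · rfl
    · simp only [ne_eq, not_not] at h; simp [h, hφ]
  let e := s.equivFin
  -- Fibres of distinct values are disjoint, so the counts in them are independent Poisson variables
  -- and the expectation factors.
  have hind := hX.indep_count s.card (fun i => g ⁻¹' {((e.symm i : s) : ℝ≥0∞)})
    (fun i => g.measurableSet_fiber _) (fun i => hfin _ (e.symm i).2) (by
      intro i j hij
      refine Set.disjoint_left.mpr fun x hx hx' => hij ?_
      have h : ((e.symm i : s) : ℝ≥0∞) = (e.symm j : s) := by
        rw [← Set.mem_singleton_iff.mp hx, ← Set.mem_singleton_iff.mp hx']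
      exact e.symm.injective (Subtype.ext h))
  have hconv : ∀ h : ℝ≥0∞ → ℝ, ∏ a ∈ s, h a = ∏ i : Fin s.card, h (e.symm i : s) := by
    intro h
    rw [← Finset.prod_coe_sort, ← Equiv.prod_comp e.symm]
  have h1 : ∀ ω, expNeg (∑' k, g (X k ω)) =
      ∏ i : Fin s.card, expNeg (((e.symm i : s) : ℝ≥0∞) *
        pointMeasure X ω (g ⁻¹' {((e.symm i : s) : ℝ≥0∞)})) := by
    intro ω
    rw [← lintegral_pointMeasure X ω g.measurable]
    have := hsum (pointMeasure X ω) id rfl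
    simp only [id] at this
    rw [this, expNeg_sum, hconv]
  simp_rw [h1]
  have hmeas : ∀ i : Fin s.card, Measurable fun t : ℝ≥0∞ =>
      expNeg (((e.symm i : s) : ℝ≥0∞) * t) := fun i =>
    measurable_expNeg.comp (measurable_const.mul measurable_id)
  rw [hind.integral_fun_prod_comp (fun i =>
    (measurable_pointMeasure_apply hX.measurable (g.measurableSet_fiber _)).aemeasurable)
    (f := fun i t => expNeg (((e.symm i : s) : ℝ≥0∞) * t))
    (fun i => (hmeas i).aestronglyMeasurable)]
  rw [hsum volume (fun a => ENNReal.ofReal (1 - expNeg a)) (by simp [expNeg_zero]),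
    Finset.mul_sum, expNeg_sum, hconv]
  refine Finset.prod_congr rfl fun i _ => ?_
  have hi := hfin _ (e.symm i).2
  have hlaw := hX.hasLaw_count _ (g.measurableSet_fiber ((e.symm i : s) : ℝ≥0∞)) hi
  have := hlaw.integral_comp (f := fun t => expNeg (((e.symm i : s) : ℝ≥0∞) * t))
    (hmeas i).aestronglyMeasurable
  simp only [Function.comp_def] at this
  rw [this, integral_expNeg_poissonMeasure, ← ENNReal.ofReal_toReal hi, ← ENNReal.ofReal_mul
    (sub_nonneg.mpr (expNeg_le_one _)), ← ENNReal.ofReal_mul hlam, expNeg_ofReal]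
  · rw [Real.coe_toNNReal _ (by positivity), measureReal_def]
    ring_nf
  · exact mul_nonneg hlam (mul_nonneg (sub_nonneg.mpr (expNeg_le_one _)) ENNReal.toReal_nonneg)

/-- Laplace functional of a homogeneous Poisson process. -/
theorem IsHomogeneousPoisson.integral_expNeg_tsum {Ω : Type*} [MeasurableSpace Ω]
    {μ : Measure Ω} [IsProbabilityMeasure μ] {X : ℕ → Ω → Plane} {lam : ℝ}
    (hX : IsHomogeneousPoisson X lam μ) (hlam : 0 ≤ lam) {f : Plane → ℝ≥0∞}
    (hf : Measurable f) :
    ∫ ω, expNeg (∑' k, f (X k ω)) ∂μ =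
      expNeg (ENNReal.ofReal lam * ∫⁻ x, ENNReal.ofReal (1 - expNeg (f x))) := by
  -- Truncation to growing balls gives supports of finite area and keeps the approximation
  -- increasing to `f`.
  let g : ℕ → SimpleFunc Plane ℝ≥0∞ := fun n =>
    (SimpleFunc.eapprox f n).restrict (Metric.ball 0 n)
  have hgval : ∀ n x, g n x = (Metric.ball (0 : Plane) n).indicator (SimpleFunc.eapprox f n) x :=
    fun n x => SimpleFunc.restrict_apply _ measurableSet_ball x
  have hfin : ∀ n, (g n).FinMeasSupp volume := by
    intro n
    rw [SimpleFunc.finMeasSupp_iff_support]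
    refine lt_of_le_of_lt (measure_mono ?_)
      (measure_ball_lt_top (μ := (volume : Measure Plane)) (x := 0) (r := n))
    intro x hx
    by_contra hxb
    exact hx (by rw [hgval, Set.indicator_of_notMem hxb])
  have hmono : ∀ x, Monotone fun n => g n x := by
    intro x m n hmn
    simp only [hgval]
    by_cases hx : x ∈ Metric.ball (0 : Plane) m
    · have hx' : x ∈ Metric.ball (0 : Plane) n :=
        Metric.ball_subset_ball (by exact_mod_cast hmn) hx
      rw [Set.indicator_of_mem hx, Set.indicator_of_mem hx']
      exact SimpleFunc.monotone_eapprox f hmn x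
    · rw [Set.indicator_of_notMem hx]
      exact zero_le
  have hlim : ∀ x, Tendsto (fun n => g n x) atTop (𝓝 (f x)) := by
    intro x
    refine (SimpleFunc.tendsto_eapprox hf x).congr' ?_
    obtain ⟨N, hN⟩ := exists_nat_gt ‖x‖
    filter_upwards [eventually_ge_atTop N] with n hn
    rw [hgval, Set.indicator_of_mem]
    rw [mem_ball_zero_iff]
    exact hN.trans_le (by exact_mod_cast hn)
  have hsum : ∀ ω, Tendsto (fun n => ∑' k, g n (X k ω)) atTop (𝓝 (∑' k, f (X k ω))) := by
    intro ω
    rw [← lintegral_pointMeasure X ω hf]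
    simp_rw [← lintegral_pointMeasure X ω (SimpleFunc.measurable _)]
    exact lintegral_tendsto_of_tendsto_of_monotone (fun n => (g n).measurable.aemeasurable)
      (ae_of_all _ hmono) (ae_of_all _ hlim)
  have hL := tendsto_integral_expNeg (μ := μ)
    (fun n => (Measurable.tsum fun k => (g n).measurable.comp (hX.measurable k)).aemeasurable) hsum
  refine tendsto_nhds_unique hL ?_
  simp only [Function.comp_def]
  simp_rw [hX.integral_expNeg_simpleFunc hlam _ (hfin _)]
  refine (continuous_expNeg.tendsto _).comp
    (ENNReal.Tendsto.const_mul ?_ (Or.inr ENNReal.ofReal_ne_top))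
  refine lintegral_tendsto_of_tendsto_of_monotone (fun n => ?_) (ae_of_all _ fun x => ?_)
    (ae_of_all _ fun x => ?_)
  · exact (measurable_const.sub (measurable_expNeg.comp (g n).measurable)).ennreal_ofReal.aemeasurable
  · intro m n hmn
    exact ENNReal.ofReal_le_ofReal (sub_le_sub_left (expNeg_antitone (hmono x hmn)) _)
  · exact ENNReal.tendsto_ofReal (tendsto_const_nhds.sub
      ((continuous_expNeg.tendsto _).comp (hlim x)))

/-! ### Averaging over independent marks -/

/-- A right inverse of `expNeg` on `[0, 1]`. -/
def negLog (y : ℝ) : ℝ≥0∞ := if y = 0 then ⊤ else ENNReal.ofReal (-Real.log y)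

lemma measurable_negLog : Measurable negLog :=
  Measurable.ite (measurableSet_singleton 0) measurable_const
    Real.measurable_log.neg.ennreal_ofReal

lemma expNeg_negLog {y : ℝ} (h0 : 0 ≤ y) (h1 : y ≤ 1) : expNeg (negLog y) = y := by
  unfold negLog
  split_ifs with h
  · rw [h, expNeg_top]
  · rw [expNeg_ofReal (neg_nonneg.mpr (Real.log_nonpos h0 h1)), neg_neg,
      Real.exp_log (lt_of_le_of_ne h0 (Ne.symm h))]

lemma integrable_expNeg_comp {E : Type*} [MeasurableSpace E] {ν : Measure E} [IsFiniteMeasure ν]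
    {F : E → ℝ≥0∞} (hF : AEMeasurable F ν) : Integrable (fun x => expNeg (F x)) ν := by
  refine Integrable.of_bound (measurable_expNeg.comp_aemeasurable hF).aestronglyMeasurable 1
    (ae_of_all _ fun x => ?_)
  rw [Real.norm_eq_abs, abs_of_nonneg (expNeg_nonneg _)]
  exact expNeg_le_one _

lemma integral_expNeg_mem_Icc {E : Type*} [MeasurableSpace E] (ν : Measure E)
    [IsProbabilityMeasure ν] {F : E → ℝ≥0∞} (hF : Measurable F) :
    0 ≤ ∫ x, expNeg (F x) ∂ν ∧ ∫ x, expNeg (F x) ∂ν ≤ 1 := by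
  refine ⟨integral_nonneg fun x => expNeg_nonneg _, ?_⟩
  calc ∫ x, expNeg (F x) ∂ν ≤ ∫ _, (1 : ℝ) ∂ν :=
        integral_mono (integrable_expNeg_comp hF.aemeasurable) (integrable_const _)
          fun x => expNeg_le_one _
    _ = 1 := by simp

lemma measurable_integral_expNeg {E K : Type*} [MeasurableSpace E] [MeasurableSpace K]
    {ν : Measure K} [SFinite ν] {h : E → K → ℝ≥0∞} (hh : Measurable (Function.uncurry h)) :
    Measurable fun x => ∫ m, expNeg (h x m) ∂ν :=
  (StronglyMeasurable.integral_prod_right (f := fun x m => expNeg (h x m))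
    (measurable_expNeg.comp hh).stronglyMeasurable).measurable

/-- Averaging over independent marks in a finite part of a marked point process. -/
lemma integral_expNeg_sum_marks {Ω K : Type*} [MeasurableSpace Ω] [MeasurableSpace K]
    {μ : Measure Ω} [IsProbabilityMeasure μ] {X : ℕ → Ω → Plane} {M : ℕ → Ω → K}
    {ν : Measure K} [IsProbabilityMeasure ν] (hX : ∀ k, Measurable (X k))
    (hM : ∀ k, HasLaw (M k) ν μ) (hind : iIndepFun M μ)
    (hXM : IndepFun (fun ω k => X k ω) (fun ω k => M k ω) μ) {h : Plane → K → ℝ≥0∞}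
    (hh : Measurable (Function.uncurry h)) (n : ℕ) :
    ∫ ω, expNeg (∑ k ∈ Finset.range n, h (X k ω) (M k ω)) ∂μ =
      ∫ ω, expNeg (∑ k ∈ Finset.range n, negLog (∫ m, expNeg (h (X k ω) m) ∂ν)) ∂μ := by
  have hXm : Measurable fun ω k => X k ω := measurable_pi_lambda _ hX
  have hMm : AEMeasurable (fun ω k => M k ω) μ := aemeasurable_pi_lambda _ fun k => (hM k).aemeasurable
  have hprod := (indepFun_iff_map_prod_eq_prod_map_map hXm.aemeasurable hMm).mp hXM
  have hF : Measurable fun z : (ℕ → Plane) × (ℕ → K) =>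
      ∑ k ∈ Finset.range n, h (z.1 k) (z.2 k) :=
    Finset.measurable_sum _ fun k _ => hh.comp (g := Function.uncurry h)
      (f := fun z : (ℕ → Plane) × (ℕ → K) => (z.1 k, z.2 k))
      (((measurable_pi_apply k).comp measurable_fst).prodMk
        ((measurable_pi_apply k).comp measurable_snd))
  have : IsProbabilityMeasure (μ.map fun ω k => X k ω) :=
    Measure.isProbabilityMeasure_map hXm.aemeasurable
  have : IsProbabilityMeasure (μ.map fun ω k => M k ω) := Measure.isProbabilityMeasure_map hMm
  have hφ : Measurable fun x => ∫ m, expNeg (h x m) ∂ν :=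
    measurable_integral_expNeg hh
  have hsec : ∀ x, Measurable (h x) := fun x => hh.comp measurable_prodMk_left
  have h1 : ∫ ω, expNeg (∑ k ∈ Finset.range n, h (X k ω) (M k ω)) ∂μ =
      ∫ z, expNeg (∑ k ∈ Finset.range n, h (z.1 k) (z.2 k))
        ∂(μ.map fun ω => ((fun k => X k ω), (fun k => M k ω))) :=
    (integral_map (hXm.aemeasurable.prodMk hMm)
      (measurable_expNeg.comp hF).aestronglyMeasurable).symm
  rw [h1, hprod, integral_prod _ (integrable_expNeg_comp hF.aemeasurable)]
  -- With the points frozen, independence of the marks factors the integral. The product is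
  -- rewritten as `expNeg` of a sum, so that the marked sum becomes a sum of a deterministic
  -- function over the points.
  have h2 : ∀ x : ℕ → Plane,
      ∫ m, expNeg (∑ k ∈ Finset.range n, h (x k) (m k)) ∂(μ.map fun ω k => M k ω) =
      expNeg (∑ k ∈ Finset.range n, negLog (∫ m, expNeg (h (x k) m) ∂ν)) := by
    intro x
    have hFx : Measurable fun m : ℕ → K => expNeg (∑ k ∈ Finset.range n, h (x k) (m k)) :=
      measurable_expNeg.comp (hF.comp (measurable_prodMk_left (x := x)))
    rw [integral_map hMm hFx.aestronglyMeasurable]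
    simp_rw [Finset.sum_range, expNeg_sum]
    have hind' : iIndepFun (fun i : Fin n => M i) μ := hind.precomp Fin.val_injective
    rw [iIndepFun.integral_fun_prod_comp (X := fun i : Fin n => M i) hind'
      (fun i => (hM i).aemeasurable) (f := fun i m => expNeg (h (x i) m))
      (fun i => (measurable_expNeg.comp (hsec _)).aestronglyMeasurable)]
    refine Finset.prod_congr rfl fun i _ => ?_
    have hI := integral_expNeg_mem_Icc ν (hsec (x i))
    rw [expNeg_negLog hI.1 hI.2]
    exact (hM i).integral_comp (f := fun m => expNeg (h (x i) m))
      (measurable_expNeg.comp (hsec _)).aestronglyMeasurable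
  simp_rw [h2]
  rw [integral_map hXm.aemeasurable]
  refine (measurable_expNeg.comp (Finset.measurable_sum _ fun k _ => ?_)).aestronglyMeasurable
  exact measurable_negLog.comp (hφ.comp (measurable_pi_apply k))

/-- Laplace functional of an independently marked homogeneous Poisson process. -/
theorem IsHomogeneousPoisson.integral_expNeg_tsum_marks {Ω K : Type*} [MeasurableSpace Ω]
    [MeasurableSpace K] {μ : Measure Ω} [IsProbabilityMeasure μ] {X : ℕ → Ω → Plane}
    {M : ℕ → Ω → K} {ν : Measure K} [IsProbabilityMeasure ν] {lam : ℝ}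
    (hX : IsHomogeneousPoisson X lam μ) (hlam : 0 ≤ lam)
    (hM : ∀ k, HasLaw (M k) ν μ) (hind : iIndepFun M μ)
    (hXM : IndepFun (fun ω k => X k ω) (fun ω k => M k ω) μ) {h : Plane → K → ℝ≥0∞}
    (hh : Measurable (Function.uncurry h)) :
    ∫ ω, expNeg (∑' k, h (X k ω) (M k ω)) ∂μ =
      expNeg (ENNReal.ofReal lam * ∫⁻ x, ENNReal.ofReal (1 - ∫ m, expNeg (h x m) ∂ν)) := by
  have hφ : Measurable fun x => ∫ m, expNeg (h x m) ∂ν :=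
    measurable_integral_expNeg hh
  have hsec : ∀ x, Measurable (h x) := fun x => hh.comp measurable_prodMk_left
  have hf : Measurable fun x => negLog (∫ m, expNeg (h x m) ∂ν) := measurable_negLog.comp hφ
  have h1 := tendsto_integral_expNeg (μ := μ)
    (F := fun n ω => ∑ k ∈ Finset.range n, h (X k ω) (M k ω))
    (fun n => Finset.aemeasurable_fun_sum _ fun k _ =>
      hh.comp_aemeasurable ((hX.measurable k).aemeasurable.prodMk (hM k).aemeasurable))
    (fun ω => ENNReal.tendsto_nat_tsum _)
  have h2 := tendsto_integral_expNeg (μ := μ)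
    (F := fun n ω => ∑ k ∈ Finset.range n, negLog (∫ m, expNeg (h (X k ω) m) ∂ν))
    (fun n => Finset.aemeasurable_fun_sum _ fun k _ => (hf.comp (hX.measurable k)).aemeasurable)
    (fun ω => ENNReal.tendsto_nat_tsum _)
  simp_rw [integral_expNeg_sum_marks hX.measurable hM hind hXM hh] at h1
  -- The finite truncations agree, hence so do their limits, and the unmarked functional applies to
  -- `negLog` of the averaged mark factor.
  rw [tendsto_nhds_unique h1 h2, hX.integral_expNeg_tsum hlam hf]
  simp_rw [fun x => expNeg_negLog (integral_expNeg_mem_Icc ν (hsec x)).1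
    (integral_expNeg_mem_Icc ν (hsec x)).2]

/-! ### Gamma tail with integer shape -/

/-- An antiderivative of the gamma density of shape `n + 1`. In the induction, the derivative of the
added term cancels the previous density and leaves the next one. -/
lemma hasDerivAt_erlang_tail (r : ℝ) (n : ℕ) (x : ℝ) :
    HasDerivAt (fun x => -(Real.exp (-(r * x)) *
        ∑ i ∈ Finset.range (n + 1), (r * x) ^ i / (i.factorial : ℝ)))
      (r ^ (n + 1) / (n.factorial : ℝ) * x ^ n * Real.exp (-(r * x))) x := by
  have hlin : HasDerivAt (fun x : ℝ => r * x) r x := by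
    simpa using (hasDerivAt_id x).const_mul r
  have hexp : HasDerivAt (fun x => Real.exp (-(r * x))) (Real.exp (-(r * x)) * -r) x :=
    hlin.neg.exp
  induction n with
  | zero =>
    refine (hexp.neg.congr_deriv ?_).congr_of_eventuallyEq (Eventually.of_forall fun y => ?_)
    · simp; ring
    · simp
  | succ n ih =>
    have hpow := (hexp.mul ((hlin.pow (n + 1)).div_const ((n + 1).factorial : ℝ))).neg
    refine ((ih.add hpow).congr_deriv ?_).congr_of_eventuallyEq
      (Eventually.of_forall fun y => ?_)
    · have hn : (n.factorial : ℝ) ≠ 0 := by positivity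
      simp only [Nat.factorial_succ, Nat.cast_mul, Nat.cast_add, Nat.cast_one,
        Nat.add_sub_cancel, Pi.pow_apply]
      field_simp
      ring
    · simp only [Finset.sum_range_succ _ (n + 1), Pi.add_apply, Pi.neg_apply, Pi.mul_apply,
        Pi.pow_apply]
      ring

/-- Tail of the gamma distribution with integer shape. -/
lemma gammaMeasure_real_Ioi {n : ℕ} (hn : 1 ≤ n) {r t : ℝ} (hr : 0 < r) (ht : 0 ≤ t) :
    (gammaMeasure n r).real (Set.Ioi t) =
      Real.exp (-(r * t)) * ∑ i ∈ Finset.range n, (r * t) ^ i / (i.factorial : ℝ) := by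
  obtain ⟨m, rfl⟩ : ∃ m, n = m + 1 := ⟨n - 1, by omega⟩
  have hlim : Tendsto (fun x => -(Real.exp (-(r * x)) *
      ∑ i ∈ Finset.range (m + 1), (r * x) ^ i / (i.factorial : ℝ))) atTop (𝓝 (-0)) := by
    refine Tendsto.neg ?_
    simp_rw [Finset.mul_sum]
    rw [show (0 : ℝ) = ∑ i ∈ Finset.range (m + 1), 0 / (i.factorial : ℝ) by simp]
    refine tendsto_finsetSum _ fun i _ => ?_
    have := ((Real.tendsto_pow_mul_exp_neg_atTop_nhds_zero i).comp
      (tendsto_id.const_mul_atTop hr)).div_const (i.factorial : ℝ)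
    refine this.congr fun x => ?_
    simp only [Function.comp_apply, id]
    ring
  have hint := integral_Ioi_of_hasDerivAt_of_nonneg' (a := t)
    (fun x _ => hasDerivAt_erlang_tail r m x)
    (fun x hx => by
      have : 0 ≤ x := ht.trans (le_of_lt hx)
      positivity) hlim
  rw [neg_zero, zero_sub, neg_neg] at hint
  rw [measureReal_def, gammaMeasure, withDensity_apply _ measurableSet_Ioi]
  unfold gammaPDF
  rw [← integral_eq_lintegral_of_nonneg_ae
    (ae_of_all _ fun x => gammaPDFReal_nonneg (by positivity) hr x)
    (measurable_gammaPDFReal _ _).aestronglyMeasurable, ← hint]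
  refine setIntegral_congr_fun measurableSet_Ioi fun x hx => ?_
  have hx0 : 0 ≤ x := ht.trans (le_of_lt hx)
  simp only [gammaPDFReal, if_pos hx0]
  rw [Real.rpow_natCast, Nat.cast_succ, Real.Gamma_nat_eq_factorial, add_sub_cancel_right,
    Real.rpow_natCast]

/-! ### Positivity of the matched scale -/

/-- Log-convexity of `Γ` at the midpoint of `m` and `m + 1`. It bounds the mean `a` of the product
of amplitudes by `1`, so that the variance `N(1 - a²)` of `S_r` is nonnegative. -/
lemma Gamma_add_half_le {m : ℝ} (hm : 0 < m) :
    Real.Gamma (m + 1 / 2) ≤ m ^ (1 / 2 : ℝ) * Real.Gamma m := by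
  have h := Real.Gamma_mul_add_mul_le_rpow_Gamma_mul_rpow_Gamma hm (by positivity : 0 < m + 1)
    (by norm_num : (0 : ℝ) < 1 / 2) (by norm_num : (0 : ℝ) < 1 / 2) (by norm_num)
  have hG := Real.Gamma_pos_of_pos hm
  rw [Real.Gamma_add_one hm.ne', Real.mul_rpow hm.le hG.le,
    show (1 / 2 : ℝ) * m + 1 / 2 * (m + 1) = m + 1 / 2 by ring] at h
  have h2 : Real.Gamma m ^ (1 / 2 : ℝ) * Real.Gamma m ^ (1 / 2 : ℝ) = Real.Gamma m := by
    rw [← Real.rpow_add hG]; norm_num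
  calc _ ≤ _ := h
    _ = m ^ (1 / 2 : ℝ) * (Real.Gamma m ^ (1 / 2 : ℝ) * Real.Gamma m ^ (1 / 2 : ℝ)) := by ring
    _ = _ := by rw [h2]

namespace Params

variable (c : Params)

lemma meanProd_pos : 0 < c.meanProd := by
  have h1 := c.mh_pos
  have h2 := c.mr_pos
  have := Real.Gamma_pos_of_pos h1
  have := Real.Gamma_pos_of_pos h2
  have := Real.Gamma_pos_of_pos (by positivity : 0 < c.mh + 1 / 2)
  have := Real.Gamma_pos_of_pos (by positivity : 0 < c.mr + 1 / 2)
  unfold meanProd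
  positivity

lemma meanProd_le_one : c.meanProd ≤ 1 := by
  have h1 := c.mh_pos
  have h2 := c.mr_pos
  have e1 : Real.Gamma (c.mh + 1 / 2) / Real.Gamma c.mh ≤ c.mh ^ (1 / 2 : ℝ) :=
    (div_le_iff₀ (Real.Gamma_pos_of_pos h1)).mpr (Gamma_add_half_le h1)
  have e2 : Real.Gamma (c.mr + 1 / 2) / Real.Gamma c.mr ≤ c.mr ^ (1 / 2 : ℝ) :=
    (div_le_iff₀ (Real.Gamma_pos_of_pos h2)).mpr (Gamma_add_half_le h2)
  have p2 := Real.Gamma_pos_of_pos h2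
  have q2 := Real.Gamma_pos_of_pos (by positivity : 0 < c.mr + 1 / 2)
  unfold meanProd
  calc _ ≤ c.mh ^ (1 / 2 : ℝ) * c.mr ^ (1 / 2 : ℝ) * (1 / (c.mh * c.mr)) ^ (1 / 2 : ℝ) := by
        gcongr
    _ = 1 := by
        rw [← Real.mul_rpow h1.le h2.le, ← Real.mul_rpow (by positivity) (by positivity),
          mul_one_div_cancel (by positivity), Real.one_rpow]

lemma meanSr_pos : 0 < c.meanSr :=
  mul_pos (Nat.cast_pos.mpr c.N_pos) c.meanProd_pos

lemma secondSr_sub_nonneg : 0 ≤ c.secondSr - c.meanSr ^ 2 := by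
  have h : c.secondSr - c.meanSr ^ 2 = c.N * (1 - c.meanProd ^ 2) := by
    unfold secondSr meanSr; ring
  rw [h]
  have := pow_le_one₀ (n := 2) c.meanProd_pos.le c.meanProd_le_one
  exact mul_nonneg (Nat.cast_nonneg _) (by linarith)

lemma kappaR_nonneg : 0 ≤ c.kappaR := div_nonneg (sq_nonneg _) c.secondSr_sub_nonneg

lemma omegaR_nonneg : 0 ≤ c.omegaR := div_nonneg c.secondSr_sub_nonneg c.meanSr_pos.le

lemma muS_zero : c.kappaR ≠ 0 → c.muS 0 = 1 := by
  intro h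
  have := Real.Gamma_pos_of_pos (lt_of_le_of_ne c.kappaR_nonneg (Ne.symm h))
  simp [muS, this.ne']

lemma muS_succ (q : ℕ) : c.kappaR ≠ 0 → c.muS (q + 1) = c.omegaR * (q + c.kappaR) * c.muS q := by
  intro h
  have hk : 0 < c.kappaR := lt_of_le_of_ne c.kappaR_nonneg (Ne.symm h)
  unfold muS
  rw [show ((q + 1 : ℕ) : ℝ) + c.kappaR = (q + c.kappaR) + 1 by push_cast; ring,
    Real.Gamma_add_one (by positivity)]
  ring

/-- The rising factorial form of the moments of the gamma distribution; it also holds in the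
degenerate case `κ_r = 0`. -/
lemma muS_eq : c.muS 1 = c.omegaR * c.kappaR ∧
    c.muS 2 = c.omegaR ^ 2 * (c.kappaR * (c.kappaR + 1)) ∧
    c.muS 3 = c.omegaR ^ 3 * (c.kappaR * (c.kappaR + 1) * (c.kappaR + 2)) ∧
    c.muS 4 = c.omegaR ^ 4 * (c.kappaR * (c.kappaR + 1) * (c.kappaR + 2) * (c.kappaR + 3)) := by
  by_cases h : c.kappaR = 0
  -- Here `Real.Gamma 0 = 0` and division by zero make every `muS q` vanish, as does the factor
  -- `κ_r` on the right.
  · simp [muS, h, Real.Gamma_zero]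
  · have h0 := c.muS_zero h
    have h1 := c.muS_succ 0 h
    have h2 := c.muS_succ 1 h
    have h3 := c.muS_succ 2 h
    have h4 := c.muS_succ 3 h
    norm_num [h0] at h1
    norm_num [h1] at h2
    norm_num [h2] at h3
    norm_num [h3] at h4
    refine ⟨h1, ?_, ?_, ?_⟩
    · rw [h2]; ring
    · rw [h3]; ring
    · rw [h4]; ring

lemma muG_two : muG 2 = 1 := by norm_num [muG, Real.Gamma_two]

lemma muG_four : muG 4 = 2 := by
  have h : muG 4 = Real.Gamma (2 + 1) := by norm_num [muG]
  rw [h, Real.Gamma_add_one (by norm_num), Real.Gamma_two, mul_one]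

lemma muG_one : muG 1 = √Real.pi / 2 := by
  have h : muG 1 = Real.Gamma (1 / 2 + 1) := by norm_num [muG]
  rw [h, Real.Gamma_add_one (by norm_num), Real.Gamma_one_half_eq]; ring

lemma muG_three : muG 3 = 3 / 2 * muG 1 := by
  have h : muG 3 = Real.Gamma (3 / 2 + 1) := by norm_num [muG]
  rw [h, Real.Gamma_add_one (by norm_num)]
  norm_num [muG]

lemma beta_nonneg : 0 ≤ c.beta := Real.sqrt_nonneg _

/-- This makes `ω_s` positive. In the expansion of the variance the only negative contribution is
compensated by `(μ^g_1)² = π/4 ≤ 1`, and the constant term `1`, the variance of `|g|²`, gives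
strictness. -/
lemma chi_pos : 0 < c.chi1 ∧ 0 < c.chi2 - c.chi1 ^ 2 := by
  obtain ⟨h1, h2, h3, h4⟩ := c.muS_eq
  have hk := c.kappaR_nonneg
  have hw := c.omegaR_nonneg
  have hb := c.beta_nonneg
  have hm : 0 ≤ muG 1 := by rw [muG_one]; positivity
  have hm2 : muG 1 ^ 2 ≤ 1 := by
    rw [muG_one, div_pow, Real.sq_sqrt Real.pi_pos.le]
    linarith [Real.pi_le_four]
  unfold chi1 chi2
  rw [h1, h2, h3, h4, muG_two, muG_four, muG_three]
  generalize c.kappaR = k at *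
  generalize c.omegaR = w at *
  generalize c.beta = b at *
  generalize muG 1 = m at *
  refine ⟨by positivity, ?_⟩
  have key : 2 + 4 * b * (3 / 2 * m) * (w * k) + 6 * b ^ 2 * 1 * (w ^ 2 * (k * (k + 1))) +
        4 * b ^ 3 * m * (w ^ 3 * (k * (k + 1) * (k + 2))) +
        b ^ 4 * (w ^ 4 * (k * (k + 1) * (k + 2) * (k + 3))) -
      (1 + 2 * b * m * (w * k) + b ^ 2 * (w ^ 2 * (k * (k + 1)))) ^ 2 =
      1 + 2 * b * m * (w * k) + 4 * b ^ 2 * w ^ 2 * (k + k ^ 2 * (1 - m ^ 2)) +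
        8 * b ^ 3 * m * w ^ 3 * (k * (k + 1)) +
        b ^ 4 * w ^ 4 * (k * (k + 1) * (4 * k + 6)) := by ring
  rw [key]
  have : 0 ≤ 1 - m ^ 2 := by linarith
  positivity

lemma omegaS_pos : 0 < c.omegaS := by
  have h := c.chi_pos
  have h0 : 0 < ‖c.T0‖ := norm_pos_iff.mpr c.T0_ne
  have hC := c.Cd_pos
  exact mul_pos (mul_pos hC (Real.rpow_pos_of_pos h0 _)) (div_pos h.2 h.1)

end Params

/-! ### Gaussian fading integrals -/

lemma integral_exp_neg_mul_sq_gaussianReal (v : ℝ≥0) {s : ℝ} (hs : 0 ≤ s) :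
    ∫ x, Real.exp (-(s * x ^ 2)) ∂(gaussianReal 0 v) = (√(1 + 2 * s * v))⁻¹ := by
  by_cases hv : v = 0
  · simp [hv]
  have hv' : 0 < (v : ℝ) := NNReal.coe_pos.mpr (pos_iff_ne_zero.mpr hv)
  rw [integral_gaussianReal_eq_integral_smul hv]
  have h : ∀ x : ℝ, gaussianPDFReal 0 v x • Real.exp (-(s * x ^ 2)) =
      (√(2 * Real.pi * v))⁻¹ * Real.exp (-(1 / (2 * v) + s) * x ^ 2) := by
    intro x
    rw [gaussianPDFReal, smul_eq_mul, mul_assoc, ← Real.exp_add]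
    congr 2
    field_simp
    ring
  simp_rw [h]
  rw [integral_const_mul, integral_gaussian, ← Real.sqrt_inv, ← Real.sqrt_inv,
    ← Real.sqrt_mul (by positivity)]
  congr 1
  field_simp

/-- A linear combination of independent centred Gaussians is Gaussian with variance `a²v + b²w`,
which reduces the claim to one dimension. That variance may be `0`. -/
lemma integral_exp_neg_mul_sq_gaussianReal_prod (v w : ℝ≥0) (a b : ℝ) {s : ℝ} (hs : 0 ≤ s) :
    ∫ z, Real.exp (-(s * (a * z.1 + b * z.2) ^ 2)) ∂((gaussianReal 0 v).prod (gaussianReal 0 w)) =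
      (√(1 + 2 * s * (a ^ 2 * v + b ^ 2 * w)))⁻¹ := by
  have hmap : ((gaussianReal 0 v).prod (gaussianReal 0 w)).map (fun z => a * z.1 + b * z.2) =
      gaussianReal 0 (NNReal.mk (a ^ 2) (sq_nonneg _) * v + NNReal.mk (b ^ 2) (sq_nonneg _) * w) := by
    have h := gaussianReal_conv_gaussianReal (m₁ := a * 0) (m₂ := b * 0)
      (v₁ := NNReal.mk (a ^ 2) (sq_nonneg _) * v) (v₂ := NNReal.mk (b ^ 2) (sq_nonneg _) * w)
    rw [← gaussianReal_map_const_mul, ← gaussianReal_map_const_mul, Measure.conv,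
      Measure.map_prod_map _ _ (by fun_prop) (by fun_prop),
      Measure.map_map (by fun_prop) (by fun_prop)] at h
    simpa [Function.comp_def] using h
  have h := integral_exp_neg_mul_sq_gaussianReal
    (NNReal.mk (a ^ 2) (sq_nonneg _) * v + NNReal.mk (b ^ 2) (sq_nonneg _) * w) hs
  rw [← hmap, integral_map (by fun_prop) (by fun_prop)] at h
  simpa using h

instance (v : ℝ≥0) : IsProbabilityMeasure (complexGaussian v) :=
  Measure.isProbabilityMeasure_map (by
    have : Measurable fun z : ℝ × ℝ => (⟨z.1, z.2⟩ : ℂ) :=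
      Complex.measurableEquivRealProd.symm.measurable
    exact this.aemeasurable)

/-- The squared modulus of a combination of independent circularly symmetric complex Gaussian
variables is exponentially distributed. -/
lemma integral_exp_neg_normSq_complexGaussian_prod (u w : ℝ≥0) (a b : ℝ) {s : ℝ} (hs : 0 ≤ s) :
    ∫ z, Real.exp (-(s * ‖(a : ℂ) * z.1 + (b : ℂ) * z.2‖ ^ 2))
        ∂((complexGaussian u).prod (complexGaussian w)) =
      (1 + s * (a ^ 2 * u + b ^ 2 * w))⁻¹ := by
  have hC : Measurable fun z : ℝ × ℝ => (⟨z.1, z.2⟩ : ℂ) :=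
    Complex.measurableEquivRealProd.symm.measurable
  unfold complexGaussian
  rw [Measure.map_prod_map _ _ hC hC, integral_map (hC.prodMap hC).aemeasurable
    (by fun_prop : Measurable _).aestronglyMeasurable]
  set G := gaussianReal 0 (u / 2)
  set H := gaussianReal 0 (w / 2)
  let K : ℝ → ℝ → ℝ := fun x y => Real.exp (-(s * (a * x + b * y) ^ 2))
  have hK : ∀ x y, K x y ∈ Set.Icc 0 1 := fun x y =>
    ⟨(Real.exp_pos _).le, Real.exp_le_one_iff.mpr (by simp only [neg_nonpos]; positivity)⟩
  -- The squared modulus splits into real and imaginary parts, which are independent with the same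
  -- law. The integral is therefore the square of a real one, which removes the square root.
  have h1 : ∀ z : (ℝ × ℝ) × (ℝ × ℝ),
      Real.exp (-(s * ‖(a : ℂ) * (Prod.map (fun z : ℝ × ℝ => (⟨z.1, z.2⟩ : ℂ))
        (fun z : ℝ × ℝ => (⟨z.1, z.2⟩ : ℂ)) z).1 + (b : ℂ) * (Prod.map
        (fun z : ℝ × ℝ => (⟨z.1, z.2⟩ : ℂ)) (fun z : ℝ × ℝ => (⟨z.1, z.2⟩ : ℂ)) z).2‖ ^ 2)) =
      K z.1.1 z.2.1 * K z.1.2 z.2.2 := by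
    intro z
    simp only [K, ← Real.exp_add]
    rw [← Complex.normSq_eq_norm_sq, Complex.normSq_apply]
    simp
    ring
  simp_rw [h1]
  have hKm : Measurable fun z : (ℝ × ℝ) × (ℝ × ℝ) => K z.1.1 z.2.1 * K z.1.2 z.2.2 := by
    simp only [K]; fun_prop
  have hKi : Integrable (fun z : (ℝ × ℝ) × (ℝ × ℝ) => K z.1.1 z.2.1 * K z.1.2 z.2.2)
      ((G.prod G).prod (H.prod H)) := by
    refine Integrable.of_bound hKm.aestronglyMeasurable 1 (ae_of_all _ fun z => ?_)
    rw [Real.norm_eq_abs, abs_of_nonneg (mul_nonneg (hK _ _).1 (hK _ _).1)]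
    exact mul_le_one₀ (hK _ _).2 (hK _ _).1 (hK _ _).2
  have hKi' : Integrable (fun z : ℝ × ℝ => K z.1 z.2) (G.prod H) := by
    refine Integrable.of_bound (by simp only [K]; fun_prop) 1 (ae_of_all _ fun z => ?_)
    rw [Real.norm_eq_abs, abs_of_nonneg (hK _ _).1]
    exact (hK _ _).2
  rw [integral_prod _ hKi]
  have h2 : ∀ x : ℝ × ℝ, ∫ y, K x.1 y.1 * K x.2 y.2 ∂(H.prod H) =
      (∫ y, K x.1 y ∂H) * ∫ y, K x.2 y ∂H := fun x => integral_prod_mul _ _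
  simp_rw [h2]
  rw [integral_prod_mul (fun x => ∫ y, K x y ∂H) (fun x => ∫ y, K x y ∂H),
    ← integral_prod (fun z : ℝ × ℝ => K z.1 z.2) hKi']
  simp only [K, G, H]
  rw [integral_exp_neg_mul_sq_gaussianReal_prod _ _ _ _ hs, ← mul_inv,
    Real.mul_self_sqrt (by positivity)]
  congr 1
  push_cast
  ring

/-! ### Laplace transform of a single interferer -/

namespace Params

variable (c : Params)

/-- The joint law of the RIS indicator, the direct fading and the scattered fading of a TX. -/
def markLaw : Measure (Bool × ℂ × ℂ) :=
  (bernoulliMeasure true false c.p).prod ((complexGaussian 1).prod (complexGaussian c.N))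

instance : IsProbabilityMeasure c.markLaw := by unfold markLaw; infer_instance

lemma etaG_nonneg {d : ℝ} (hd : 0 ≤ d) : 0 ≤ c.etaG d :=
  mul_nonneg c.Cd_pos.le (Real.rpow_nonneg hd _)

lemma etaH_nonneg {d : ℝ} (hd : 0 ≤ d) : 0 ≤ c.etaH d :=
  mul_nonneg c.Cr_pos.le (Real.rpow_nonneg (mul_nonneg c.d0_pos.le hd) _)

/-- Source of `e₁`: with both distances equal, the direct and reflected variances decay with the
same power and add up. -/
lemma etaG_add_etaH {d : ℝ} (hd : 0 ≤ d) :
    c.etaG d + c.etaH d * c.N = c.e1 * d ^ (-c.α) := by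
  unfold etaG etaH e1
  rw [Real.mul_rpow c.d0_pos.le hd]
  ring

lemma e1_pos : 0 < c.e1 := by
  have := c.Cd_pos
  have := c.Cr_pos
  have := c.d0_pos
  unfold e1
  positivity

lemma interfTerm_nonneg (x : Plane) (m : Bool × ℂ × ℂ) : 0 ≤ c.interfTerm x m := by
  unfold interfTerm interfRIS interfDirect
  split_ifs <;> positivity

lemma measurable_interfTerm : Measurable (Function.uncurry c.interfTerm) := by
  have h : Function.uncurry c.interfTerm = fun z : Plane × Bool × ℂ × ℂ =>
      if z.2.1 = true then c.interfRIS ‖z.1‖ ‖z.1‖ z.2.2.1 z.2.2.2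
      else c.interfDirect ‖z.1‖ z.2.2.1 := rfl
  rw [h]
  refine Measurable.ite (measurableSet_eq_fun (by fun_prop) measurable_const) ?_ ?_
  · unfold interfRIS etaG etaH; fun_prop
  · unfold interfDirect etaG; fun_prop

/-- The Laplace transform of the interference power of a single TX. -/
lemma integral_exp_neg_interfTerm (x : Plane) {s : ℝ} (hs : 0 ≤ s) :
    ∫ m, expNeg (ENNReal.ofReal (s * c.interfTerm x m)) ∂c.markLaw =
      c.p * (1 + s * c.e1 * ‖x‖ ^ (-c.α))⁻¹ + (1 - c.p) * (1 + s * c.Cd * ‖x‖ ^ (-c.α))⁻¹ := by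
  have hm : Measurable fun m => ENNReal.ofReal (s * c.interfTerm x m) :=
    ((c.measurable_interfTerm.comp (measurable_prodMk_left (x := x))).const_mul s).ennreal_ofReal
  have hg := Real.sq_sqrt (c.etaG_nonneg (norm_nonneg x))
  have hh := Real.sq_sqrt (c.etaH_nonneg (norm_nonneg x))
  unfold markLaw
  rw [integral_prod _ (integrable_expNeg_comp hm.aemeasurable), integral_bernoulliMeasure]
  simp_rw [expNeg_ofReal (mul_nonneg hs (c.interfTerm_nonneg x _))]
  have h1 := integral_exp_neg_normSq_complexGaussian_prod 1 c.N (√(c.etaG ‖x‖)) (√(c.etaH ‖x‖)) hs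
  -- The coefficient `0` encodes a TX without RIS.
  have h2 := integral_exp_neg_normSq_complexGaussian_prod 1 c.N (√(c.etaG ‖x‖)) 0 hs
  rw [hg, hh] at h1
  rw [hg] at h2
  simp only [interfTerm, interfRIS, interfDirect, if_true, Bool.false_eq_true, if_false, smul_eq_mul]
  simp only [Complex.ofReal_zero, zero_mul, add_zero] at h2
  rw [h1, h2]
  have h3 := c.etaG_add_etaH (norm_nonneg x)
  congr 3
  · rw [mul_assoc s, ← h3]; simp
  · simp [etaG]; ring

end Params

/-! ### The planar path loss integral -/

/-- A nonzero Bochner integral certifies integrability, since its default value is `0`. -/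
lemma lintegral_ofReal_of_integral_pos {E : Type*} [MeasurableSpace E] {ν : Measure E} {f : E → ℝ}
    (hf : 0 ≤ᵐ[ν] f) (h : 0 < ∫ x, f x ∂ν) :
    ∫⁻ x, ENNReal.ofReal (f x) ∂ν = ENNReal.ofReal (∫ x, f x ∂ν) :=
  (ofReal_integral_eq_lintegral_ofReal (Integrable.of_integral_ne_zero h.ne') hf).symm

/-- Write `1/(y^α + c) = ∫ e^{-(y^α + c)t} dt` and exchange the integrals by Tonelli. The
`y`-integral produces `Γ(2/α)`, the `t`-integral `Γ(1 - 2/α)`, where `α > 2` is needed, and the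
reflection formula turns their product into the cosecant. -/
lemma lintegral_mul_div_rpow_add {α c : ℝ} (hα : 2 < α) (hc : 0 < c) :
    ∫⁻ y in Set.Ioi (0 : ℝ), ENNReal.ofReal (y * (c / (y ^ α + c))) =
      ENNReal.ofReal (Real.pi / α * (1 / Real.sin (2 * Real.pi / α)) * c ^ (2 / α)) := by
  have hα0 : 0 < α := by linarith
  have hlt : 2 / α < 1 := (div_lt_one hα0).mpr hα
  have hpos : 0 < 2 / α := by positivity
  have hG1 := Real.Gamma_pos_of_pos hpos
  have hG2 := Real.Gamma_pos_of_pos (sub_pos.mpr hlt)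
  have hexp : ∀ y ∈ Set.Ioi (0 : ℝ), ENNReal.ofReal (y * (c / (y ^ α + c))) =
      ∫⁻ t in Set.Ioi (0 : ℝ), ENNReal.ofReal (c * y * Real.exp (-(y ^ α + c) * t)) := by
    intro y hy
    have hy0 : 0 < y := hy
    have hd : 0 < y ^ α + c := by positivity
    have hi : ∫ t in Set.Ioi (0 : ℝ), c * y * Real.exp (-(y ^ α + c) * t) =
        y * (c / (y ^ α + c)) := by
      rw [integral_const_mul, integral_exp_mul_Ioi (by linarith), mul_zero, Real.exp_zero, neg_div_neg_eq]
      ring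
    rw [lintegral_ofReal_of_integral_pos (ae_of_all _ fun t => by positivity)
      (by rw [hi]; positivity), hi]
  have hinner : ∀ t ∈ Set.Ioi (0 : ℝ),
      ∫⁻ y in Set.Ioi (0 : ℝ), ENNReal.ofReal (c * y * Real.exp (-(y ^ α + c) * t)) =
      ENNReal.ofReal ((c * (1 / α) * Real.Gamma (2 / α)) *
        (t ^ ((1 - 2 / α) - 1) * Real.exp (-(c * t)))) := by
    intro t ht
    have ht0 : 0 < t := ht
    have hi : ∫ y in Set.Ioi (0 : ℝ), c * y * Real.exp (-(y ^ α + c) * t) =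
        (c * (1 / α) * Real.Gamma (2 / α)) * (t ^ ((1 - 2 / α) - 1) * Real.exp (-(c * t))) := by
      have h := integral_rpow_mul_exp_neg_mul_rpow hα0 (by norm_num : (-1 : ℝ) < 1) ht0
      have h' : ∀ y : ℝ, c * y * Real.exp (-(y ^ α + c) * t) =
          (c * Real.exp (-(c * t))) * (y ^ (1 : ℝ) * Real.exp (-t * y ^ α)) := by
        intro y
        rw [Real.rpow_one, show -(y ^ α + c) * t = -(c * t) + -t * y ^ α by ring, Real.exp_add]
        ring
      simp_rw [h']
      rw [integral_const_mul, h, show (1 - 2 / α) - 1 = -(1 + 1) / α by ring,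
        show ((1 : ℝ) + 1) / α = 2 / α by norm_num]
      ring
    rw [lintegral_ofReal_of_integral_pos _ (by rw [hi]; positivity), hi]
    refine (ae_restrict_iff' measurableSet_Ioi).mpr (ae_of_all _ fun y hy => ?_)
    have hy0 : 0 < y := hy
    show 0 ≤ c * y * Real.exp (-(y ^ α + c) * t)
    positivity
  rw [setLIntegral_congr_fun measurableSet_Ioi hexp, lintegral_lintegral_swap,
    setLIntegral_congr_fun measurableSet_Ioi hinner]
  · have hi : ∫ t in Set.Ioi (0 : ℝ), (c * (1 / α) * Real.Gamma (2 / α)) *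
        (t ^ ((1 - 2 / α) - 1) * Real.exp (-(c * t))) =
        Real.pi / α * (1 / Real.sin (2 * Real.pi / α)) * c ^ (2 / α) := by
      rw [integral_const_mul, Real.integral_rpow_mul_exp_neg_mul_Ioi (sub_pos.mpr hlt) hc]
      have hrefl := Real.Gamma_mul_Gamma_one_sub (2 / α)
      rw [Real.div_rpow zero_le_one hc.le, Real.one_rpow, Real.rpow_sub hc, Real.rpow_one]
      have hc2 : c ^ (2 / α) ≠ 0 := (Real.rpow_pos_of_pos hc _).ne'
      calc _ = 1 / α * c ^ (2 / α) * (Real.Gamma (2 / α) * Real.Gamma (1 - 2 / α)) := by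
            field_simp
        _ = _ := by
            rw [hrefl, show Real.pi * (2 / α) = 2 * Real.pi / α by ring]
            ring
    have hsin : 0 < Real.sin (2 * Real.pi / α) := by
      refine Real.sin_pos_of_pos_of_lt_pi (by positivity) ?_
      rw [div_lt_iff₀ hα0]
      nlinarith [Real.pi_pos]
    rw [lintegral_ofReal_of_integral_pos _ (by rw [hi]; positivity), hi]
    refine (ae_restrict_iff' measurableSet_Ioi).mpr (ae_of_all _ fun t ht => ?_)
    have ht0 : 0 < t := ht
    show 0 ≤ (c * (1 / α) * Real.Gamma (2 / α)) * (t ^ ((1 - 2 / α) - 1) * Real.exp (-(c * t)))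
    positivity
  · exact Measurable.aemeasurable (by fun_prop)

/-- The planar integral of `c |x|^{-α} / (1 + c |x|^{-α})`. -/
lemma integrable_and_integral_pathloss {α c : ℝ} (hα : 2 < α) (hc : 0 ≤ c) :
    Integrable (fun x : Plane => 1 - (1 + c * ‖x‖ ^ (-α))⁻¹) ∧
    ∫ x : Plane, (1 - (1 + c * ‖x‖ ^ (-α))⁻¹) =
      2 * Real.pi ^ 2 / α * (1 / Real.sin (2 * Real.pi / α)) * c ^ (2 / α) := by
  have hα0 : 0 < α := by linarith
  rcases hc.eq_or_lt with rfl | hc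
  · simp [Real.zero_rpow (by positivity : 2 / α ≠ 0)]
  have hlin := lintegral_mul_div_rpow_add hα hc
  have hcongr : ∀ y ∈ Set.Ioi (0 : ℝ), y * (c / (y ^ α + c)) =
      y ^ (Module.finrank ℝ Plane - 1) • (1 - (1 + c * y ^ (-α))⁻¹) := by
    intro y hy
    have hy0 : 0 < y := hy
    have hya := Real.rpow_pos_of_pos hy0 α
    rw [Real.rpow_neg hy0.le, finrank_euclideanSpace_fin]
    simp only [Nat.add_one_sub_one, pow_one, smul_eq_mul]
    field_simp
    ring
  have hnn : ∀ y ∈ Set.Ioi (0 : ℝ), 0 ≤ y * (c / (y ^ α + c)) := by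
    intro y hy
    have hy0 : 0 < y := hy
    positivity
  have hnn' : 0 ≤ᵐ[volume.restrict (Set.Ioi (0 : ℝ))] fun y => y * (c / (y ^ α + c)) :=
    (ae_restrict_iff' measurableSet_Ioi).mpr (ae_of_all _ hnn)
  have hmeas : Measurable fun y : ℝ => y * (c / (y ^ α + c)) := by fun_prop
  have hint : IntegrableOn (fun y : ℝ => y * (c / (y ^ α + c))) (Set.Ioi 0) := by
    refine (lintegral_ofReal_ne_top_iff_integrable hmeas.aestronglyMeasurable hnn').mp ?_
    rw [hlin]
    exact ENNReal.ofReal_ne_top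
  have hval : ∫ y in Set.Ioi (0 : ℝ), y * (c / (y ^ α + c)) =
      Real.pi / α * (1 / Real.sin (2 * Real.pi / α)) * c ^ (2 / α) := by
    have hsin : 0 < Real.sin (2 * Real.pi / α) := by
      refine Real.sin_pos_of_pos_of_lt_pi (by positivity) ?_
      rw [div_lt_iff₀ hα0]
      nlinarith [Real.pi_pos]
    rw [integral_eq_lintegral_of_nonneg_ae hnn' hmeas.aestronglyMeasurable, hlin,
      ENNReal.toReal_ofReal (by positivity)]
  refine ⟨(integrable_fun_norm_addHaar volume (f := fun y => 1 - (1 + c * y ^ (-α))⁻¹)).mpr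
    (hint.congr_fun hcongr measurableSet_Ioi), ?_⟩
  -- In polar coordinates the dimension `2` times the area `π` of the unit disc supplies the factor
  -- `2π`.
  rw [integral_fun_norm_addHaar volume (fun y => 1 - (1 + c * y ^ (-α))⁻¹),
    ← setIntegral_congr_fun measurableSet_Ioi hcongr, hval, measureReal_def,
    EuclideanSpace.volume_ball_fin_two, finrank_euclideanSpace_fin]
  simp [ENNReal.toReal_ofReal Real.pi_pos.le]
  ring

/-! ### Laplace exponent and total interference -/

namespace Params

variable (c : Params)

/-- The exponent of the Laplace transform of the interference power. -/
def laplaceExponent (s : ℝ) : ℝ :=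
  2 * Real.pi ^ 2 * c.lam * c.p * (1 / Real.sin (2 * Real.pi / c.α)) *
      (c.e1 * s) ^ (2 / c.α) / c.α
    + 2 * Real.pi ^ 2 * c.lam * (1 - c.p) * (1 / Real.sin (2 * Real.pi / c.α)) *
      (c.Cd * s) ^ (2 / c.α) / c.α

lemma laplaceExponent_zero : c.laplaceExponent 0 = 0 := by
  have hα : 2 / c.α ≠ 0 := by have := c.two_lt_α; positivity
  simp [laplaceExponent, Real.zero_rpow hα]

lemma continuous_laplaceExponent : Continuous c.laplaceExponent := by
  have hα : 0 ≤ 2 / c.α := by have := c.two_lt_α; positivity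
  have h1 : Continuous fun s : ℝ => (c.e1 * s) ^ (2 / c.α) :=
    (continuous_const.mul continuous_id).rpow_const fun _ => Or.inr hα
  have h2 : Continuous fun s : ℝ => (c.Cd * s) ^ (2 / c.α) :=
    (continuous_const.mul continuous_id).rpow_const fun _ => Or.inr hα
  unfold laplaceExponent
  fun_prop

lemma V_eq (thr s : ℝ) : c.V thr s =
    -(s * thr / c.omegaS * c.snr⁻¹) - c.laplaceExponent (s * thr / c.omegaS) := by
  unfold V laplaceExponent
  rw [show c.e1 * thr / c.omegaS * s = c.e1 * (s * thr / c.omegaS) by ring,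
    show c.Cd * thr / c.omegaS * s = c.Cd * (s * thr / c.omegaS) by ring]
  ring

/-- The interference power as an element of `[0, ∞]`. -/
def totalInterf (x : ℕ → Plane) (m : ℕ → Bool × ℂ × ℂ) : ℝ≥0∞ :=
  ∑' k, ENNReal.ofReal (c.interfTerm (x k) (m k))

/-- No summability is needed: for a divergent series both sides take the default value `0`. -/
lemma tsum_interfTerm (x : ℕ → Plane) (m : ℕ → Bool × ℂ × ℂ) :
    ∑' k, c.interfTerm (x k) (m k) = (c.totalInterf x m).toReal := by
  rw [totalInterf, ENNReal.tsum_toReal_eq fun _ => ENNReal.ofReal_ne_top]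
  exact tsum_congr fun k => (ENNReal.toReal_ofReal (c.interfTerm_nonneg _ _)).symm

lemma summable_interfTerm {x : ℕ → Plane} {m : ℕ → Bool × ℂ × ℂ}
    (h : c.totalInterf x m ≠ ⊤) : Summable fun k => c.interfTerm (x k) (m k) :=
  (ENNReal.summable_toReal h).congr fun _ => ENNReal.toReal_ofReal (c.interfTerm_nonneg _ _)

lemma measurable_totalInterf :
    Measurable fun z : (ℕ → Plane) × (ℕ → Bool × ℂ × ℂ) => c.totalInterf z.1 z.2 := by
  refine Measurable.tsum fun k => Measurable.ennreal_ofReal ?_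
  exact c.measurable_interfTerm.comp (g := Function.uncurry c.interfTerm)
    (f := fun z : (ℕ → Plane) × (ℕ → Bool × ℂ × ℂ) => (z.1 k, z.2 k))
    (((measurable_pi_apply k).comp measurable_fst).prodMk
      ((measurable_pi_apply k).comp measurable_snd))

lemma snr_pos : 0 < c.snr := div_pos c.P_pos c.noise_pos

end Params

/-! ### Law of the interference and conditional coverage -/

namespace IsFixedAssociation

variable {c : Params} {Ω : Type*} [MeasurableSpace Ω] {μ : Measure Ω}
  {S : Ω → ℝ} {X : ℕ → Ω → Plane} {M : ℕ → Ω → Bool × ℂ × ℂ}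

lemma aemeasurable_configuration (hmodel : IsFixedAssociation c μ S X M) :
    AEMeasurable (fun ω => ((fun k => X k ω), (fun k => M k ω))) μ :=
  (measurable_pi_lambda _ hmodel.poisson.measurable).aemeasurable.prodMk
    (aemeasurable_pi_lambda _ fun k => (hmodel.law_mark k).aemeasurable)

lemma aemeasurable_totalInterf (hmodel : IsFixedAssociation c μ S X M) :
    AEMeasurable (fun ω => c.totalInterf (fun k => X k ω) (fun k => M k ω)) μ :=
  c.measurable_totalInterf.comp_aemeasurable hmodel.aemeasurable_configuration

/-- Laplace transform of the interference power. -/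
lemma integral_expNeg_totalInterf [IsProbabilityMeasure μ] (hmodel : IsFixedAssociation c μ S X M) {s : ℝ} (hs : 0 ≤ s) :
    ∫ ω, expNeg (ENNReal.ofReal s * c.totalInterf (fun k => X k ω) (fun k => M k ω)) ∂μ =
      Real.exp (-c.laplaceExponent s) := by
  have h1 : ∀ ω, ENNReal.ofReal s * c.totalInterf (fun k => X k ω) (fun k => M k ω) =
      ∑' k, ENNReal.ofReal (s * c.interfTerm (X k ω) (M k ω)) := fun ω => by
    simp_rw [Params.totalInterf, ENNReal.ofReal_mul hs, ENNReal.tsum_mul_left]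
  simp_rw [h1]
  have hm : Measurable (Function.uncurry fun (x : Plane) (m : Bool × ℂ × ℂ) =>
      ENNReal.ofReal (s * c.interfTerm x m)) :=
    (c.measurable_interfTerm.const_mul s).ennreal_ofReal
  rw [hmodel.poisson.integral_expNeg_tsum_marks c.lam_pos.le (ν := c.markLaw) hmodel.law_mark
    hmodel.indep_mark hmodel.indep_points_marks hm]
  simp_rw [c.integral_exp_neg_interfTerm _ hs]
  obtain ⟨i1, v1⟩ := integrable_and_integral_pathloss c.two_lt_α (mul_nonneg hs c.e1_pos.le)
  obtain ⟨i2, v2⟩ := integrable_and_integral_pathloss c.two_lt_α (mul_nonneg hs c.Cd_pos.le)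
  have hp0 : 0 ≤ (c.p : ℝ) := c.p.2.1
  have hp1 : 0 ≤ 1 - (c.p : ℝ) := sub_nonneg.mpr c.p.2.2
  have hsplit : ∀ x : Plane,
      1 - (c.p * (1 + s * c.e1 * ‖x‖ ^ (-c.α))⁻¹ + (1 - c.p) * (1 + s * c.Cd * ‖x‖ ^ (-c.α))⁻¹) =
      c.p * (1 - (1 + s * c.e1 * ‖x‖ ^ (-c.α))⁻¹) +
        (1 - c.p) * (1 - (1 + s * c.Cd * ‖x‖ ^ (-c.α))⁻¹) := fun x => by ring
  simp_rw [hsplit]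
  have hnn : ∀ b : ℝ, 0 ≤ b → ∀ x : Plane, 0 ≤ 1 - (1 + b * ‖x‖ ^ (-c.α))⁻¹ := fun b hb x =>
    sub_nonneg.mpr (inv_le_one_of_one_le₀ (le_add_of_nonneg_right
      (mul_nonneg hb (Real.rpow_nonneg (norm_nonneg x) _))))
  have hnn1 := hnn _ (mul_nonneg hs c.e1_pos.le)
  have hnn2 := hnn _ (mul_nonneg hs c.Cd_pos.le)
  have hnn3 : ∀ x : Plane, 0 ≤ c.p * (1 - (1 + s * c.e1 * ‖x‖ ^ (-c.α))⁻¹) +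
        (1 - c.p) * (1 - (1 + s * c.Cd * ‖x‖ ^ (-c.α))⁻¹) := fun x =>
    add_nonneg (mul_nonneg hp0 (hnn1 x)) (mul_nonneg hp1 (hnn2 x))
  have hi : Integrable (fun x : Plane => c.p * (1 - (1 + s * c.e1 * ‖x‖ ^ (-c.α))⁻¹) +
        (1 - c.p) * (1 - (1 + s * c.Cd * ‖x‖ ^ (-c.α))⁻¹)) :=
    (i1.const_mul _).add (i2.const_mul _)
  rw [← ofReal_integral_eq_lintegral_ofReal hi (ae_of_all _ hnn3), ← ENNReal.ofReal_mul c.lam_pos.le,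
    expNeg_ofReal (mul_nonneg c.lam_pos.le (integral_nonneg hnn3)),
    integral_add (i1.const_mul _) (i2.const_mul _), integral_const_mul, integral_const_mul, v1, v2,
    Params.laplaceExponent, mul_comm s, mul_comm s]
  ring_nf

/-- The interference power is almost surely finite. -/
lemma ae_totalInterf_ne_top [IsProbabilityMeasure μ] (hmodel : IsFixedAssociation c μ S X M) :
    ∀ᵐ ω ∂μ, c.totalInterf (fun k => X k ω) (fun k => M k ω) ≠ ⊤ := by
  classical
  set J : Ω → ℝ≥0∞ := fun ω => c.totalInterf (fun k => X k ω) (fun k => M k ω) with hJ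
  have hJm : AEMeasurable J μ := hmodel.aemeasurable_totalInterf
  -- The pointwise limit of `s * J` as `s` decreases to `0`, so that `E e^{-G}` is the probability
  -- that `J` is finite.
  let G : Ω → ℝ≥0∞ := fun ω => if J ω = ⊤ then ⊤ else 0
  have hs0 : Tendsto (fun n : ℕ => 1 / ((n : ℝ) + 1)) atTop (𝓝 0) :=
    tendsto_one_div_add_atTop_nhds_zero_nat
  have hlim : ∀ ω, Tendsto (fun n : ℕ => ENNReal.ofReal (1 / ((n : ℝ) + 1)) * J ω) atTop
      (𝓝 (G ω)) := by
    intro ω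
    by_cases h : J ω = ⊤
    · simp only [G, h, if_true]
      refine tendsto_const_nhds.congr fun n => ?_
      rw [ENNReal.mul_top]
      exact (ENNReal.ofReal_pos.mpr (by positivity)).ne'
    · simp only [G, h, if_false]
      have := ENNReal.Tendsto.mul_const (b := J ω) (ENNReal.tendsto_ofReal hs0) (Or.inr h)
      simpa using this
  have h1 := tendsto_integral_expNeg (μ := μ) (fun n => hJm.const_mul _) hlim
  have hL : ∀ n : ℕ, ∫ ω, expNeg (ENNReal.ofReal (1 / ((n : ℝ) + 1)) * J ω) ∂μ =
      Real.exp (-c.laplaceExponent (1 / ((n : ℝ) + 1))) := fun n =>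
    hmodel.integral_expNeg_totalInterf (by positivity)
  simp_rw [hL] at h1
  have h2 : Tendsto (fun n : ℕ => Real.exp (-c.laplaceExponent (1 / ((n : ℝ) + 1)))) atTop
      (𝓝 1) := by
    have := ((Real.continuous_exp.comp c.continuous_laplaceExponent.neg).tendsto 0).comp hs0
    simpa [Function.comp_def, c.laplaceExponent_zero] using this
  have hG : ∫ ω, expNeg (G ω) ∂μ = 1 := tendsto_nhds_unique h1 h2
  have hGm : AEMeasurable G μ := aemeasurable_of_tendsto_metrizable_ae'
    (fun n => hJm.const_mul _) (ae_of_all _ hlim)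
  have hGi := integrable_expNeg_comp hGm
  have hz : ∫ ω, (1 - expNeg (G ω)) ∂μ = 0 := by
    rw [integral_sub (integrable_const _) hGi, hG]; simp
  have hae := (integral_eq_zero_iff_of_nonneg (fun ω => sub_nonneg.mpr (expNeg_le_one (G ω)))
    ((integrable_const _).sub hGi)).mp hz
  filter_upwards [hae] with ω hω htop
  have : G ω = ⊤ := by simp only [G, hJ, htop, if_true]
  simp [this, expNeg_top] at hω

/-- Coverage probability in terms of the incomplete exponential sums of the interference power. -/
lemma measureReal_coverage [IsProbabilityMeasure μ] (hmodel : IsFixedAssociation c μ S X M) {thr : ℝ} (hthr : 0 ≤ thr) :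
    μ.real {ω | thr < c.sinr (S ω) (fun k => X k ω) (fun k => M k ω)} =
      ∫ ω, Real.exp (-(thr / c.omegaS *
          ((c.totalInterf (fun k => X k ω) (fun k => M k ω)).toReal + c.snr⁻¹))) *
        ∑ i ∈ Finset.range c.kappaHat, (thr / c.omegaS *
          ((c.totalInterf (fun k => X k ω) (fun k => M k ω)).toReal + c.snr⁻¹)) ^ i /
            (i.factorial : ℝ) ∂μ := by
  have hω := c.omegaS_pos
  have hsnr := inv_pos.mpr c.snr_pos
  have hk : 1 ≤ c.kappaHat := le_max_left _ _
  set I : Ω → ℝ := fun ω => (c.totalInterf (fun k => X k ω) (fun k => M k ω)).toReal with hI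
  have hI0 : ∀ ω, 0 ≤ I ω := fun ω => ENNReal.toReal_nonneg
  have hIm : AEMeasurable I μ := hmodel.aemeasurable_totalInterf.ennreal_toReal
  have hind : IndepFun S I μ := hmodel.indep_signal.comp measurable_id
    (c.measurable_totalInterf.ennreal_toReal)
  have hprod := (indepFun_iff_map_prod_eq_prod_map_map hmodel.law_signal.aemeasurable hIm).mp hind
  -- As the SINR denominator is positive, coverage is a half-line condition on `S` given `I`. By
  -- independence `S` can be integrated out first.
  set A : Set (ℝ × ℝ) := {z | thr * (z.2 + c.snr⁻¹) < z.1} with hA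
  have hAm : MeasurableSet A := measurableSet_lt (by fun_prop) (by fun_prop)
  have hset : {ω | thr < c.sinr (S ω) (fun k => X k ω) (fun k => M k ω)} =
      (fun ω => (S ω, I ω)) ⁻¹' A := by
    ext ω
    have : 0 < I ω + c.snr⁻¹ := by linarith [hI0 ω]
    simp only [Params.sinr, Params.tsum_interfTerm, Set.mem_ofPred_eq, hA, Set.mem_preimage]
    exact lt_div_iff₀ this
  let T : ℝ → ℝ := fun y => Real.exp (-(thr / c.omegaS * (y + c.snr⁻¹))) *
    ∑ i ∈ Finset.range c.kappaHat, (thr / c.omegaS * (y + c.snr⁻¹)) ^ i / (i.factorial : ℝ)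
  have hTm : Measurable T := by simp only [T]; fun_prop
  have : IsProbabilityMeasure (gammaMeasure c.kappaHat (1 / c.omegaS)) :=
    isProbabilityMeasure_gammaMeasure (by exact_mod_cast hk) (by positivity)
  have : IsProbabilityMeasure (μ.map I) := Measure.isProbabilityMeasure_map hIm
  have hsec : ∀ y, 0 ≤ y → gammaMeasure c.kappaHat (1 / c.omegaS) ((fun x => (x, y)) ⁻¹' A) =
      ENNReal.ofReal (T y) := by
    intro y hy
    have h1 : (fun x => (x, y)) ⁻¹' A = Set.Ioi (thr * (y + c.snr⁻¹)) := rfl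
    have h2 : 1 / c.omegaS * (thr * (y + c.snr⁻¹)) = thr / c.omegaS * (y + c.snr⁻¹) := by ring
    rw [h1, ← ofReal_measureReal, gammaMeasure_real_Ioi hk (by positivity) (by positivity), h2]
  rw [hset, measureReal_def, ← Measure.map_apply_of_aemeasurable
    (hmodel.law_signal.aemeasurable.prodMk hIm) hAm, hprod, hmodel.law_signal.map_eq,
    Measure.prod_apply_symm hAm, lintegral_map' (measurable_measure_prodMk_right hAm).aemeasurable
      hIm]
  have h3 : ∀ ω, gammaMeasure c.kappaHat (1 / c.omegaS) ((fun x => (x, I ω)) ⁻¹' A) =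
      ENNReal.ofReal (T (I ω)) := fun ω => hsec _ (hI0 ω)
  simp_rw [h3]
  have hTI : AEMeasurable (fun ω => T (I ω)) μ := hTm.comp_aemeasurable hIm
  rw [← integral_eq_lintegral_of_nonneg_ae (ae_of_all _ fun ω => ?_)
    hTI.aestronglyMeasurable]
  have := hI0 ω
  simp only [T, Pi.zero_apply]
  positivity

/-- Almost sure finiteness of the interference is essential here: `toReal` would send `⊤` to `0`,
where `expNeg` vanishes but the real exponential does not. -/
lemma mgf_scaled_interf [IsProbabilityMeasure μ] (hmodel : IsFixedAssociation c μ S X M) {thr s : ℝ} (hthr : 0 ≤ thr)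
    (hs : 0 ≤ s) :
    mgf (fun ω => -(thr / c.omegaS *
      ((c.totalInterf (fun k => X k ω) (fun k => M k ω)).toReal + c.snr⁻¹))) μ s =
      Real.exp (c.V thr s) := by
  have hω := c.omegaS_pos
  have hs' : 0 ≤ s * thr / c.omegaS := by positivity
  rw [c.V_eq, sub_eq_add_neg, Real.exp_add, ← hmodel.integral_expNeg_totalInterf hs',
    ← integral_const_mul, mgf]
  refine integral_congr_ae ?_
  filter_upwards [hmodel.ae_totalInterf_ne_top] with ω hfin
  rw [expNeg_of_ne_top (ENNReal.mul_ne_top ENNReal.ofReal_ne_top hfin), ENNReal.toReal_mul,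
    ENNReal.toReal_ofReal hs', ← Real.exp_add]
  congr 1
  ring

end IsFixedAssociation

end RISNetwork

end

/-! ### Coverage as derivatives of the moment generating function -/

theorem proposition3 (c : RISNetwork.Params) {Ω : Type*} [MeasurableSpace Ω]
    (μ : Measure Ω) [IsProbabilityMeasure μ]
    (S : Ω → ℝ) (X : ℕ → Ω → RISNetwork.Plane) (M : ℕ → Ω → Bool × ℂ × ℂ)
    (hmodel : RISNetwork.IsFixedAssociation c μ S X M)
    (thr : ℝ) (hthr : 0 ≤ thr) :
    (∀ᵐ ω ∂μ, Summable fun k => c.interfTerm (X k ω) (M k ω)) ∧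
    μ.real {ω | thr < c.sinr (S ω) (fun k => X k ω) (fun k => M k ω)} =
      ∑ i ∈ Finset.range c.kappaHat, (-1 : ℝ) ^ i / (i.factorial : ℝ) *
        iteratedDeriv i (fun s => Real.exp (c.V thr s)) 1 := by
  refine ⟨hmodel.ae_totalInterf_ne_top.mono fun ω h => c.summable_interfTerm h, ?_⟩
  have hω := c.omegaS_pos
  have hsnr := inv_pos.mpr c.snr_pos
  rw [hmodel.measureReal_coverage hthr]
  set Y : Ω → ℝ := fun ω => thr / c.omegaS *
    ((c.totalInterf (fun k => X k ω) (fun k => M k ω)).toReal + c.snr⁻¹) with hY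
  have hY0 : ∀ ω, 0 ≤ Y ω := fun ω => by
    have : 0 ≤ (c.totalInterf (fun k => X k ω) (fun k => M k ω)).toReal := ENNReal.toReal_nonneg
    simp only [hY]
    positivity
  have hYm : AEMeasurable Y μ :=
    (hmodel.aemeasurable_totalInterf.ennreal_toReal.add_const _).const_mul _
  -- Since `Y ≥ 0`, `e^{-tY} ≤ 1` for `t > 0`. Thus `1` is an interior point and differentiation
  -- under the integral requires no moments of `Y`.
  have hsub : Set.Ioi (0 : ℝ) ⊆ integrableExpSet (fun ω => -Y ω) μ := by
    intro t ht
    have ht0 : 0 < t := ht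
    refine Integrable.of_bound
      (Real.measurable_exp.comp_aemeasurable (hYm.neg.const_mul t)).aestronglyMeasurable 1
      (ae_of_all _ fun ω => ?_)
    rw [Real.norm_eq_abs, abs_of_pos (Real.exp_pos _), Real.exp_le_one_iff]
    nlinarith [mul_nonneg ht0.le (hY0 ω)]
  have hmem : (1 : ℝ) ∈ interior (integrableExpSet (fun ω => -Y ω) μ) :=
    interior_mono hsub (by rw [interior_Ioi]; exact Set.mem_Ioi.mpr one_pos)
  -- The identity is only available for `s ≥ 0`, but agreement near `1` determines all derivatives
  -- there.
  have hV : (fun s => Real.exp (c.V thr s)) =ᶠ[nhds 1] mgf (fun ω => -Y ω) μ := by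
    filter_upwards [Ioi_mem_nhds (one_pos : (0 : ℝ) < 1)] with s hs
    exact (hmodel.mgf_scaled_interf hthr (le_of_lt hs)).symm
  have hterm : ∀ i ω, Real.exp (-Y ω) * (Y ω ^ i / (i.factorial : ℝ)) =
      (-1 : ℝ) ^ i / (i.factorial : ℝ) * ((-Y ω) ^ i * Real.exp (1 * -Y ω)) := by
    intro i ω
    have : (-1 : ℝ) ^ i * (-1) ^ i = 1 := by rw [← mul_pow]; norm_num
    rw [neg_pow (Y ω) i, one_mul]
    calc _ = ((-1 : ℝ) ^ i * (-1) ^ i) * (Real.exp (-Y ω) * (Y ω ^ i / (i.factorial : ℝ))) := by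
          rw [this, one_mul]
      _ = _ := by ring
  have hsum : ∀ ω, Real.exp (-Y ω) * ∑ i ∈ Finset.range c.kappaHat, Y ω ^ i / (i.factorial : ℝ) =
      ∑ i ∈ Finset.range c.kappaHat,
        (-1 : ℝ) ^ i / (i.factorial : ℝ) * ((-Y ω) ^ i * Real.exp (1 * -Y ω)) := fun ω => by
    rw [Finset.mul_sum]
    exact Finset.sum_congr rfl fun i _ => hterm i ω
  rw [integral_congr_ae (ae_of_all _ hsum)]
  rw [integral_finsetSum _ fun i _ =>
    (integrable_pow_mul_exp_of_mem_interior_integrableExpSet hmem i).const_mul _]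
  refine Finset.sum_congr rfl fun i _ => ?_
  rw [integral_const_mul, hV.iteratedDeriv_eq, iteratedDeriv_mgf hmem]
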